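/- **Theorem.** Let $\mathcal X$ be a finite state space and let $Q$ be the generator of an irreducible continuous-time Markov chain on $\mathcal X$, reversible with respect to a probability measure $\pi$, i.e. $\pi(x)Q(x,y)=\pi(y)Q(y,x)$ for all $x,y$. Let $U:\mathcal X\to\mathbb R$ satisfy $\min_{x}U(x)=0$. A path from $x$ to $y$ is a sequence $x=\gamma_0,\gamma_1,\dots,\gamma_n=y$ with $n\ge 1$ and $Q(\gamma_{i-1},\gamma_i)>0$ for $1\le i\le n$; let $\Gamma^{x,y}$ be the set of these paths, and put $$H_2(x,y)=\min_{\gamma\in\Gamma^{x,y}}\ \max_{1\le i\le n}\min\{U(\gamma_{i-1}),U(\gamma_i)\},\qquad c_{M_2}=\max_{x,y\in\mathcal X}\{H_2(x,y)-U(x)-U(y)\}.$$ Suppose that $c_{M_2}>0$, let $\epsilon>0$ and $$T(t)=\frac{c_{M_2}+\epsilon}{\log(t+1)},\qquad t\ge 0,$$ where $T(0)=\infty$, i.e. $1/T(0)=0$. Let $X^{M_2}$ be the non-homogeneous continuous-time Markov chain on $\mathcal X$ with generator $M_{2,t}$ at time $t\ge0$, where $$M_{2,t}(x,y)=Q(x,y)\max\{1,e^{(U(x)-U(y))/T(t)}\}\quad(x\ne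 y),\qquad M_{2,t}(x,x)=-\sum_{z\ne x}M_{2,t}(x,z),$$ and let $(P_{s,t})_{0\le s\le t}$ be its transition semigroup. Let $$\pi_{T(t)}(x)=\frac{e^{-U(x)/T(t)}\pi(x)}{\sum_{y}e^{-U(y)/T(t)}\pi(y)}$$ be the Gibbs measures, let $U_{min}$ be the set of global minima of $U$, and let $\pi_{min}(x)=\pi(x)/\pi(U_{min})$ for $x\in U_{min}$ and $\pi_{min}(x)=0$ otherwise. Then: 1. $X^{M_2}$ is strongly ergodic and converges to $\pi_{min}$ in total variation: $\pi_{min}$ is a probability measure and, for every $s\ge 0$, $$\lim_{t\to\infty}\ \sup_{x\in\mathcal X}\ \tfrac12\sum_{y\in\mathcal X}|P_{s,t}(x,y)-\pi_{min}(y)|=0.$$ 2. $X^{M_2}$ converges in relative entropy: for every $t\ge0$ the probability measure $\pi_{T(t)}$ is stationary for $M_{2,t}$ and, for every $x\in\mathcal X$, $$\lim_{t\to\infty}\ \sum_{y\in\mathcal X}P_{0,t}(x,y)\log\frac{P_{0,t}(x,y)}{\pi_{T(t)}(y)}=0,$$ with the convention $0\log 0=0$. -/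

import Mathlib

open Filter Topology

namespace Annealing

/-- `Q` is the generator of a continuous-time Markov chain on the finite set `X`: nonnegative
off-diagonal rates and vanishing row sums. -/
structure IsGenerator {X : Type*} [Fintype X] (Q : Matrix X X ℝ) : Prop where
  nonneg_of_ne : ∀ x y, x ≠ y → 0 ≤ Q x y
  row_sum : ∀ x, ∑ y, Q x y = 0

/-- A path `x = x₀, x₁, …, xₙ = y` with `n ≥ 1` and `Q(xᵢ₋₁, xᵢ) > 0` for `i = 1, …, n`. -/
structure StatePath {X : Type*} (Q : Matrix X X ℝ) (x y : X) where
  /-- the number `n` of steps -/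
  length : ℕ
  length_pos : 0 < length
  /-- the points `x₀, …, xₙ` -/
  vertex : Fin (length + 1) → X
  vertex_zero : vertex 0 = x
  vertex_last : vertex (Fin.last length) = y
  step : ∀ i : Fin length, 0 < Q (vertex i.castSucc) (vertex i.succ)

/-- Irreducibility: any two distinct states are joined by a path. On a finite state space this
is ergodicity of the continuous-time chain. -/
def IsIrreducible {X : Type*} (Q : Matrix X X ℝ) : Prop :=
  ∀ x y, x ≠ y → Nonempty (StatePath Q x y)

/-- Detailed balance of `Q` with respect to `π`. -/
def IsReversible {X : Type*} (Q : Matrix X X ℝ) (π : X → ℝ) : Prop :=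
  ∀ x y, π x * Q x y = π y * Q y x

/-- `μ` is a stationary probability measure of the generator `Q`. -/
def IsStationary {X : Type*} [Fintype X] (Q : Matrix X X ℝ) (μ : X → ℝ) : Prop :=
  μ ∈ stdSimplex ℝ X ∧ ∀ y, ∑ x, μ x * Q x y = 0

/-- `Elev₂(γ)`, the maximum over the steps of `γ` of `U(γᵢ₋₁) ∧ U(γᵢ)` (a maximum over a
nonempty finite index set). -/
noncomputable def elev₂ {X : Type*} {Q : Matrix X X ℝ} (U : X → ℝ) {x y : X}
    (γ : StatePath Q x y) : ℝ :=
  ⨆ i : Fin γ.length, min (U (γ.vertex i.castSucc)) (U (γ.vertex i.succ))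

/-- `H₂(x, y)`, the minimum of `Elev₂` over the paths from `x` to `y`. On a finite state space
`Elev₂` takes finitely many values, so the infimum is attained as soon as there is a path. -/
noncomputable def height₂ {X : Type*} (Q : Matrix X X ℝ) (U : X → ℝ) (x y : X) : ℝ :=
  ⨅ γ : StatePath Q x y, elev₂ U γ

/-- `c_{M₂} = max_{x, y} (H₂(x, y) - U(x) - U(y))`. -/
noncomputable def cM₂ {X : Type*} (Q : Matrix X X ℝ) (U : X → ℝ) : ℝ :=
  ⨆ p : X × X, (height₂ Q U p.1 p.2 - U p.1 - U p.2)

/-- The generator of the variant at temperature `T`: off-diagonal rates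
`Q(x, y) max(1, exp((U(x) - U(y)) / T))`, and diagonal entries making the row sums vanish.
As `a / 0 = 0`, the value `0` of `T` plays the role of infinite temperature here. -/
noncomputable def generatorM₂ {X : Type*} [Fintype X] [DecidableEq X]
    (Q : Matrix X X ℝ) (U : X → ℝ) (T : ℝ) : Matrix X X ℝ :=
  fun x y =>
    if x = y then -∑ z ∈ Finset.univ.erase x, Q x z * max 1 (Real.exp ((U x - U z) / T))
    else Q x y * max 1 (Real.exp ((U x - U y) / T))

/-- The Gibbs distribution `π_T(x) = exp(-U(x) / T) π(x) / Z_T` (again `T = 0` is read as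
infinite temperature). -/
noncomputable def gibbs {X : Type*} [Fintype X] (π U : X → ℝ) (T : ℝ) (x : X) : ℝ :=
  Real.exp (-U x / T) * π x / ∑ y, Real.exp (-U y / T) * π y

/-- The logarithmic cooling schedule `c / log(t + 1)`. At `t = 0`, where the temperature is
infinite, Lean's value is `0`, which `generatorM₂` and `gibbs` read as infinite temperature. -/
noncomputable def logCooling (c t : ℝ) : ℝ :=
  c / Real.log (t + 1)

/-- The set of global minima of `U`. -/
def globalMinima {X : Type*} (U : X → ℝ) : Set X :=
  {x | ∀ y, U x ≤ U y}

open Classical in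
/-- `π_min`: the probability measure `π` restricted to the global minima of `U` and normalized. -/
noncomputable def piMin {X : Type*} [Fintype X] (π U : X → ℝ) (x : X) : ℝ :=
  if x ∈ globalMinima U then
    π x / ∑ y ∈ Finset.univ.filter (fun y => y ∈ globalMinima U), π y
  else 0

/-- `P s t x y`, `0 ≤ s ≤ t`, are the transition probabilities (from `x` at time `s` to `y` at
time `t`) of the non-homogeneous Markov chain with generators `M t`: stochastic matrices with
`P s s = 1` that satisfy the Chapman–Kolmogorov equation and Kolmogorov's forward equation
`∂ₜ P s t = P s t * M t` (one-sided derivative at `t = s`). Values of `P` and `M` outside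
`0 ≤ s ≤ t` play no role. -/
structure IsTransitionSemigroup {X : Type*} [Fintype X] [DecidableEq X]
    (M : ℝ → Matrix X X ℝ) (P : ℝ → ℝ → Matrix X X ℝ) : Prop where
  stochastic : ∀ s t, 0 ≤ s → s ≤ t → ∀ x, P s t x ∈ stdSimplex ℝ X
  refl : ∀ s, 0 ≤ s → P s s = 1
  chapman_kolmogorov : ∀ r s t, 0 ≤ r → r ≤ s → s ≤ t → P r t = P r s * P s t
  forward : ∀ s t, 0 ≤ s → s ≤ t → ∀ x y,
    HasDerivWithinAt (fun u => P s u x y) ((P s t * M t) x y) (Set.Ici s) t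

/-- Total variation distance. -/
noncomputable def tvDist {X : Type*} [Fintype X] (μ ν : X → ℝ) : ℝ :=
  (1 / 2) * ∑ x, |μ x - ν x|

/-- The chain with transition semigroup `P` is strongly ergodic with limit the probability
measure `μ`: for every `s ≥ 0`, `sup_x ‖P_{s,t}(x, ·) - μ‖_TV → 0` as `t → ∞`. -/
def IsStronglyErgodicTo {X : Type*} [Fintype X]
    (P : ℝ → ℝ → Matrix X X ℝ) (μ : X → ℝ) : Prop :=
  μ ∈ stdSimplex ℝ X ∧
    ∀ s, 0 ≤ s → Tendsto (fun t => ⨆ x, tvDist (P s t x) μ) atTop (𝓝 0)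

/-- Strong ergodicity: there is a limiting probability measure. -/
def IsStronglyErgodic {X : Type*} [Fintype X] (P : ℝ → ℝ → Matrix X X ℝ) : Prop :=
  ∃ μ, IsStronglyErgodicTo P μ

/-- Relative entropy `Ent_ν(μ) = ∑ μ log(μ / ν)`, with `0 log 0 = 0`. -/
noncomputable def relEntropy {X : Type*} [Fintype X] (ν μ : X → ℝ) : ℝ :=
  ∑ x, μ x * Real.log (μ x / ν x)

/-- Convergence in relative entropy of the chain with generators `M t` and transition semigroup
`P` to the stationary measures `μ t` of `M t`. -/
def ConvergesInRelEntropy {X : Type*} [Fintype X] (M : ℝ → Matrix X X ℝ)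
    (P : ℝ → ℝ → Matrix X X ℝ) (μ : ℝ → X → ℝ) : Prop :=
  (∀ t, 0 ≤ t → IsStationary (M t) (μ t)) ∧
    ∀ x, Tendsto (fun t => relEntropy (μ t) (P 0 t x)) atTop (𝓝 0)

end Annealing

/-!
Let `c > cM₂ Q U`, `T(t) = c / log (t + 1)`, `g_t` the Gibbs measure at temperature `T(t)` and
`μ_t` the law of the chain started at a given point at time `s`. Everything follows from the
convergence to `0` of the chi-square divergence `V(t) = ∑ μ_t² / g_t - 1`, because `√V(t)`
dominates the total variation distance of `μ_t` to `g_t` and `V(t)` dominates the relative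
entropy, while `g_t` tends to `piMin`.

The generator at temperature `T` is reversible with respect to the Gibbs measure, the edge `(x, y)`
carrying the weight `π(x) Q(x, y) exp (-min (U x) (U y) / T) / Z`. Comparing the variance of a
function with its increments along paths of least `elev₂` gives a Poincaré inequality with
spectral gap at least `A exp (-cM₂ / T)` (`exists_poincare`), that is, at least `A (t + 1) ^ (-α)`
with `α = cM₂ / c < 1` along the cooling schedule. The temporal variation of the Gibbs measure
costs only a term of order `1 / (t + 1)` (`exists_hasDerivAt_chiSq_gibbs`), so that
`V' ≤ -2 A (t + 1) ^ (-α) V + B / (t + 1) * (V + 1)`. Since `α < 1`, the gap has infinite integral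
and dominates the perturbation, and `V` tends to `0` (`tendsto_zero_of_deriv_le`).
-/

open Filter Topology

namespace Annealing

variable {X : Type*}

/-! ### Positivity of the reversible measure and optimal paths -/

lemma pos_of_isReversible [Fintype X] {Q : Matrix X X ℝ} {π : X → ℝ}
    (hirr : IsIrreducible Q) (hπ : π ∈ stdSimplex ℝ X) (hrev : IsReversible Q π) (y : X) :
    0 < π y := by
  obtain ⟨x, hx⟩ : ∃ x, 0 < π x := by
    by_contra! h
    have h1 := hπ.2
    have h2 : ∑ x, π x ≤ 0 := Finset.sum_nonpos fun x _ => h x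
    linarith
  by_cases hxy : x = y
  · exact hxy ▸ hx
  obtain ⟨γ⟩ := hirr x y hxy
  have key : ∀ k : Fin (γ.length + 1), 0 < π (γ.vertex k) := by
    intro k
    induction k using Fin.induction with
    | zero => rw [γ.vertex_zero]; exact hx
    | succ i ih =>
      have h := mul_pos ih (γ.step i)
      rw [hrev] at h
      refine lt_of_le_of_ne (hπ.1 _) fun h0 => ?_
      rw [← h0, zero_mul] at h
      exact lt_irrefl _ h
  simpa [γ.vertex_last] using key (Fin.last _)

lemma exists_elev₂_eq_height₂ [Finite X] {Q : Matrix X X ℝ} (U : X → ℝ) {x y : X}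
    (h : Nonempty (StatePath Q x y)) : ∃ γ : StatePath Q x y, elev₂ U γ = height₂ Q U x y := by
  have hfin : (Set.range fun γ : StatePath Q x y => elev₂ U γ).Finite := by
    refine (Set.finite_range fun p : X × X => min (U p.1) (U p.2)).subset ?_
    rintro _ ⟨γ, rfl⟩
    have : Nonempty (Fin γ.length) := ⟨⟨0, γ.length_pos⟩⟩
    obtain ⟨i, hi⟩ := exists_eq_ciSup_of_finite
      (f := fun i : Fin γ.length => min (U (γ.vertex i.castSucc)) (U (γ.vertex i.succ)))
    exact ⟨(γ.vertex i.castSucc, γ.vertex i.succ), hi⟩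
  exact (Set.range_nonempty _).csInf_mem hfin

lemma height₂_sub_le_cM₂ [Finite X] (Q : Matrix X X ℝ) (U : X → ℝ) (x y : X) :
    height₂ Q U x y - U x - U y ≤ cM₂ Q U :=
  le_ciSup (f := fun p : X × X => height₂ Q U p.1 p.2 - U p.1 - U p.2)
    (Set.finite_range _).bddAbove (x, y)

/-! ### Increments along canonical paths -/

lemma edge_term_nonneg [Fintype X] {Q : Matrix X X ℝ} {π : X → ℝ} (hQ : IsGenerator Q)
    (hπ : ∀ x, 0 < π x) (U f : X → ℝ) (T : ℝ) (a b : X) :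
    0 ≤ π a * Q a b * Real.exp (-min (U a) (U b) / T) * (f a - f b) ^ 2 := by
  by_cases h : a = b
  · simp [h]
  · have := hQ.nonneg_of_ne a b h
    have := hπ a
    positivity

/-- Telescoping along `γ` and the Cauchy-Schwarz inequality bound the squared increment of `f`
between the endpoints by the Dirichlet sum, the weight of each edge of `γ` being at least a
constant times `exp (-elev₂ U γ / T)`. -/
lemma StatePath.sq_sub_le [Fintype X] {Q : Matrix X X ℝ} {π : X → ℝ} (hQ : IsGenerator Q)
    (hπ : ∀ x, 0 < π x) (U : X → ℝ) {x y : X} (γ : StatePath Q x y) {T : ℝ} (hT : 0 ≤ T)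
    (f : X → ℝ) :
    (f x - f y) ^ 2 ≤
      (γ.length * ∑ i : Fin γ.length,
        (π (γ.vertex i.castSucc) * Q (γ.vertex i.castSucc) (γ.vertex i.succ))⁻¹) *
      Real.exp (elev₂ U γ / T) *
      ∑ a, ∑ b, π a * Q a b * Real.exp (-min (U a) (U b) / T) * (f a - f b) ^ 2 := by
  set D := ∑ a, ∑ b, π a * Q a b * Real.exp (-min (U a) (U b) / T) * (f a - f b) ^ 2 with hD
  have htel : f y - f x = ∑ i : Fin γ.length, (f (γ.vertex i.succ) - f (γ.vertex i.castSucc)) := by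
    have h1 := Fin.sum_univ_succ fun k => f (γ.vertex k)
    have h2 := Fin.sum_univ_castSucc fun k => f (γ.vertex k)
    rw [γ.vertex_zero] at h1
    rw [γ.vertex_last] at h2
    rw [Finset.sum_sub_distrib]
    linarith
  have hedge : ∀ i : Fin γ.length, (f (γ.vertex i.succ) - f (γ.vertex i.castSucc)) ^ 2 ≤
      (π (γ.vertex i.castSucc) * Q (γ.vertex i.castSucc) (γ.vertex i.succ))⁻¹ *
        (Real.exp (elev₂ U γ / T) * D) := by
    intro i
    set a := γ.vertex i.castSucc
    set b := γ.vertex i.succ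
    have hq : 0 < π a * Q a b := mul_pos (hπ a) (γ.step i)
    have hle : π a * Q a b * Real.exp (-min (U a) (U b) / T) * (f a - f b) ^ 2 ≤ D := by
      refine le_trans ?_ (Finset.single_le_sum
        (f := fun a => ∑ b, π a * Q a b * Real.exp (-min (U a) (U b) / T) * (f a - f b) ^ 2)
        (fun a _ => Finset.sum_nonneg fun b _ => edge_term_nonneg hQ hπ U f T a b)
        (Finset.mem_univ a))
      exact Finset.single_le_sum
        (f := fun b => π a * Q a b * Real.exp (-min (U a) (U b) / T) * (f a - f b) ^ 2)
        (fun b _ => edge_term_nonneg hQ hπ U f T a b) (Finset.mem_univ b)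
    have hmin : min (U a) (U b) ≤ elev₂ U γ :=
      le_ciSup (f := fun i : Fin γ.length => min (U (γ.vertex i.castSucc)) (U (γ.vertex i.succ)))
        (Set.finite_range _).bddAbove i
    rw [inv_mul_eq_div, le_div_iff₀ hq]
    calc (f b - f a) ^ 2 * (π a * Q a b)
        = Real.exp (min (U a) (U b) / T) *
          (π a * Q a b * Real.exp (-min (U a) (U b) / T) * (f a - f b) ^ 2) := by
          rw [neg_div, Real.exp_neg]
          field_simp
          ring
      _ ≤ Real.exp (elev₂ U γ / T) * D := by
          refine mul_le_mul ?_ hle (edge_term_nonneg hQ hπ U f T a b) (Real.exp_pos _).le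
          exact Real.exp_le_exp.2 (div_le_div_of_nonneg_right hmin hT)
  calc (f x - f y) ^ 2
      = (∑ i : Fin γ.length, (f (γ.vertex i.succ) - f (γ.vertex i.castSucc))) ^ 2 := by
        rw [← htel]; ring
    _ ≤ γ.length * ∑ i : Fin γ.length, (f (γ.vertex i.succ) - f (γ.vertex i.castSucc)) ^ 2 := by
        simpa using sq_sum_le_card_mul_sum_sq (s := (Finset.univ : Finset (Fin γ.length)))
          (f := fun i => f (γ.vertex i.succ) - f (γ.vertex i.castSucc))
    _ ≤ γ.length * ∑ i : Fin γ.length,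
        (π (γ.vertex i.castSucc) * Q (γ.vertex i.castSucc) (γ.vertex i.succ))⁻¹ *
          (Real.exp (elev₂ U γ / T) * D) := by
        gcongr with i; exact hedge i
    _ = _ := by rw [← Finset.sum_mul]; ring

/-- The contribution of one pair of points to the variance. The path of least `elev₂` depends
neither on `T` nor on `f`, hence neither does the constant. -/
lemma exists_pair_bound [Fintype X] {Q : Matrix X X ℝ} {π : X → ℝ} (hQ : IsGenerator Q)
    (hirr : IsIrreducible Q) (hπ : ∀ x, 0 < π x) (U : X → ℝ) (x y : X) :
    ∃ K : ℝ, 0 ≤ K ∧ ∀ T : ℝ, 0 ≤ T → ∀ f : X → ℝ,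
      (Real.exp (-U x / T) * π x) * (Real.exp (-U y / T) * π y) * (f x - f y) ^ 2 ≤
        K * Real.exp (cM₂ Q U / T) *
        ∑ a, ∑ b, π a * Q a b * Real.exp (-min (U a) (U b) / T) * (f a - f b) ^ 2 := by
  by_cases hxy : x = y
  · exact ⟨0, le_rfl, fun T _ f => by simp [hxy]⟩
  obtain ⟨γ, hγ⟩ := exists_elev₂_eq_height₂ U (hirr x y hxy)
  set C := γ.length * ∑ i : Fin γ.length,
    (π (γ.vertex i.castSucc) * Q (γ.vertex i.castSucc) (γ.vertex i.succ))⁻¹ with hC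
  have hC0 : 0 ≤ C := mul_nonneg (Nat.cast_nonneg _) <| Finset.sum_nonneg fun i _ =>
    inv_nonneg.2 (mul_pos (hπ _) (γ.step i)).le
  have hx := hπ x
  have hy := hπ y
  refine ⟨π x * π y * C, by positivity, fun T hT f => ?_⟩
  have h := γ.sq_sub_le hQ hπ U hT f
  rw [← hC] at h
  set D := ∑ a, ∑ b, π a * Q a b * Real.exp (-min (U a) (U b) / T) * (f a - f b) ^ 2 with hD
  have hD0 : 0 ≤ D := Finset.sum_nonneg fun a _ => Finset.sum_nonneg fun b _ =>
    edge_term_nonneg hQ hπ U f T a b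
  have hexp : Real.exp (-U x / T) * Real.exp (-U y / T) * Real.exp (elev₂ U γ / T) ≤
      Real.exp (cM₂ Q U / T) := by
    rw [← Real.exp_add, ← Real.exp_add, ← add_div, ← add_div, hγ]
    refine Real.exp_le_exp.2 (div_le_div_of_nonneg_right ?_ hT)
    linarith [height₂_sub_le_cM₂ Q U x y]
  calc _ ≤ (Real.exp (-U x / T) * π x) * (Real.exp (-U y / T) * π y) *
        (C * Real.exp (elev₂ U γ / T) * D) := by gcongr
    _ = π x * π y * C * D *
        (Real.exp (-U x / T) * Real.exp (-U y / T) * Real.exp (elev₂ U γ / T)) := by ring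
    _ ≤ π x * π y * C * D * Real.exp (cM₂ Q U / T) := by gcongr
    _ = _ := by ring

/-! ### Gibbs measures and detailed balance -/

lemma partition_pos [Fintype X] [Nonempty X] {π : X → ℝ} (hπ : ∀ x, 0 < π x) (U : X → ℝ)
    (T : ℝ) : 0 < ∑ y, Real.exp (-U y / T) * π y :=
  Finset.sum_pos (fun y _ => mul_pos (Real.exp_pos _) (hπ y)) Finset.univ_nonempty

lemma gibbs_pos [Fintype X] [Nonempty X] {π : X → ℝ} (hπ : ∀ x, 0 < π x) (U : X → ℝ)
    (T : ℝ) (x : X) : 0 < gibbs π U T x :=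
  div_pos (mul_pos (Real.exp_pos _) (hπ x)) (partition_pos hπ U T)

lemma sum_gibbs [Fintype X] [Nonempty X] {π : X → ℝ} (hπ : ∀ x, 0 < π x) (U : X → ℝ)
    (T : ℝ) : ∑ x, gibbs π U T x = 1 := by
  simp only [gibbs]
  rw [← Finset.sum_div, div_self (partition_pos hπ U T).ne']

/-- The symmetric edge weight of the generator at temperature `T`. -/
lemma gibbs_mul_generatorM₂ [Fintype X] [DecidableEq X] (Q : Matrix X X ℝ) (π U : X → ℝ)
    {T : ℝ} (hT : 0 ≤ T) {x y : X} (hxy : x ≠ y) :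
    gibbs π U T x * generatorM₂ Q U T x y =
      π x * Q x y * Real.exp (-min (U x) (U y) / T) / ∑ z, Real.exp (-U z / T) * π z := by
  have key : Real.exp (-U x / T) * max 1 (Real.exp ((U x - U y) / T)) =
      Real.exp (-min (U x) (U y) / T) := by
    rcases le_total (U x) (U y) with h | h
    · rw [min_eq_left h, max_eq_left, mul_one]
      exact Real.exp_le_one_iff.2 (div_nonpos_of_nonpos_of_nonneg (by linarith) hT)
    · rw [min_eq_right h, max_eq_right, ← Real.exp_add, ← add_div]
      · congr 2; ring
      · exact Real.one_le_exp (div_nonneg (by linarith) hT)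
  rw [← key, gibbs, generatorM₂, if_neg hxy]
  ring

lemma isReversible_generatorM₂ [Fintype X] [DecidableEq X] {Q : Matrix X X ℝ} {π : X → ℝ}
    (hrev : IsReversible Q π) (U : X → ℝ) {T : ℝ} (hT : 0 ≤ T) :
    IsReversible (generatorM₂ Q U T) (gibbs π U T) := by
  intro x y
  by_cases hxy : x = y
  · rw [hxy]
  · rw [gibbs_mul_generatorM₂ Q π U hT hxy, gibbs_mul_generatorM₂ Q π U hT (Ne.symm hxy),
      hrev x y, min_comm]

lemma sum_generatorM₂ [Fintype X] [DecidableEq X] (Q : Matrix X X ℝ) (U : X → ℝ) (T : ℝ)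
    (x : X) : ∑ y, generatorM₂ Q U T x y = 0 := by
  rw [← Finset.add_sum_erase _ _ (Finset.mem_univ x)]
  have : ∑ y ∈ Finset.univ.erase x, generatorM₂ Q U T x y =
      ∑ y ∈ Finset.univ.erase x, Q x y * max 1 (Real.exp ((U x - U y) / T)) :=
    Finset.sum_congr rfl fun y hy => by
      rw [generatorM₂, if_neg (Finset.ne_of_mem_erase hy).symm]
  rw [this, generatorM₂, if_pos rfl, neg_add_cancel]

/-! ### Dirichlet form, variance and the Poincaré inequality -/

lemma IsReversible.sum_mul [Fintype X] {M : Matrix X X ℝ} {μ : X → ℝ} (hM : ∀ x, ∑ y, M x y = 0)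
    (hrev : IsReversible M μ) (y : X) : ∑ x, μ x * M x y = 0 := by
  simp_rw [hrev _ y, ← Finset.mul_sum, hM, mul_zero]

/-- The Dirichlet form of a reversible generator as a sum of squared increments. -/
lemma IsReversible.sum_mul_sum [Fintype X] {M : Matrix X X ℝ} {μ : X → ℝ}
    (hM : ∀ x, ∑ y, M x y = 0) (hrev : IsReversible M μ) (f : X → ℝ) :
    2 * ∑ y, f y * ∑ x, μ x * f x * M x y = -∑ x, ∑ y, μ x * M x y * (f x - f y) ^ 2 := by
  have h1 : ∑ x, ∑ y, μ x * M x y * f x ^ 2 = 0 :=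
    Finset.sum_eq_zero fun x _ => by
      rw [← Finset.sum_mul, ← Finset.mul_sum, hM, mul_zero, zero_mul]
  have h2 : ∑ x, ∑ y, μ x * M x y * f y ^ 2 = 0 := by
    rw [Finset.sum_comm]
    exact Finset.sum_eq_zero fun y _ => by
      rw [← Finset.sum_mul, hrev.sum_mul hM, zero_mul]
  have h3 : ∑ y, f y * ∑ x, μ x * f x * M x y = ∑ x, ∑ y, μ x * M x y * (f x * f y) := by
    rw [Finset.sum_comm]
    refine Finset.sum_congr rfl fun y _ => ?_
    rw [Finset.mul_sum]
    exact Finset.sum_congr rfl fun x _ => by ring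
  have h4 : ∑ x, ∑ y, μ x * M x y * (f x - f y) ^ 2 =
      ∑ x, ∑ y, μ x * M x y * f x ^ 2 + ∑ x, ∑ y, μ x * M x y * f y ^ 2 -
        2 * ∑ x, ∑ y, μ x * M x y * (f x * f y) := by
    simp only [Finset.mul_sum, ← Finset.sum_add_distrib, ← Finset.sum_sub_distrib]
    exact Finset.sum_congr rfl fun x _ => Finset.sum_congr rfl fun y _ => by ring
  rw [h3, h4, h1, h2]
  ring

/-- The variance of `f` as a double sum of squared increments. -/
lemma sum_sum_mul_sq_sub [Fintype X] {μ : X → ℝ} (hμ : ∑ x, μ x = 1) (f : X → ℝ) :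
    ∑ x, ∑ y, μ x * μ y * (f x - f y) ^ 2 =
      2 * (∑ x, μ x * f x ^ 2 - (∑ x, μ x * f x) ^ 2) := by
  have h : ∀ x y, μ x * μ y * (f x - f y) ^ 2 =
      μ x * f x ^ 2 * μ y + μ x * (μ y * f y ^ 2) - 2 * ((μ x * f x) * (μ y * f y)) := by
    intro x y; ring
  simp only [h, Finset.sum_sub_distrib, Finset.sum_add_distrib, ← Finset.mul_sum,
    ← Finset.sum_mul, hμ]
  ring

/-- Poincaré inequality: the spectral gap at temperature `T` is at least `A exp (-cM₂ / T)`, with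
`A` independent of `T`. The value `T = 0` stands for infinite temperature, as in `generatorM₂`. -/
theorem exists_poincare [Fintype X] [Nonempty X] [DecidableEq X] {Q : Matrix X X ℝ} {π : X → ℝ}
    (hQ : IsGenerator Q) (hirr : IsIrreducible Q) (hπ : ∀ x, 0 < π x) {U : X → ℝ}
    (hU : ∃ x, U x = 0) :
    ∃ A : ℝ, 0 < A ∧ ∀ T : ℝ, 0 ≤ T → ∀ f : X → ℝ,
      2 * A * Real.exp (-cM₂ Q U / T) *
        (∑ x, gibbs π U T x * f x ^ 2 - (∑ x, gibbs π U T x * f x) ^ 2) ≤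
      ∑ x, ∑ y, gibbs π U T x * generatorM₂ Q U T x y * (f x - f y) ^ 2 := by
  choose K hK0 hK using fun x y => exists_pair_bound hQ hirr hπ U x y
  obtain ⟨x₀, hx₀⟩ := hU
  have hS : 0 ≤ ∑ x, ∑ y, K x y := Finset.sum_nonneg fun x _ => Finset.sum_nonneg fun y _ => hK0 x y
  -- `1 +` keeps the constant positive on a one-point space
  set S := 1 + ∑ x, ∑ y, K x y with hSdef
  have hSpos : 0 < S := by positivity
  refine ⟨π x₀ / S, div_pos (hπ x₀) hSpos, fun T hT f => ?_⟩
  set Z := ∑ z, Real.exp (-U z / T) * π z with hZ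
  have hZpos : 0 < Z := partition_pos hπ U T
  have hZx₀ : π x₀ ≤ Z := by
    have := Finset.single_le_sum (f := fun z => Real.exp (-U z / T) * π z)
      (fun z _ => (mul_pos (Real.exp_pos _) (hπ z)).le) (Finset.mem_univ x₀)
    simpa [hx₀] using this
  set D := ∑ a, ∑ b, π a * Q a b * Real.exp (-min (U a) (U b) / T) * (f a - f b) ^ 2 with hD
  have hD0 : 0 ≤ D := Finset.sum_nonneg fun a _ => Finset.sum_nonneg fun b _ =>
    edge_term_nonneg hQ hπ U f T a b
  have hR : ∑ x, ∑ y, gibbs π U T x * generatorM₂ Q U T x y * (f x - f y) ^ 2 = D / Z := by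
    rw [hD, Finset.sum_div]
    refine Finset.sum_congr rfl fun x _ => ?_
    rw [Finset.sum_div]
    refine Finset.sum_congr rfl fun y _ => ?_
    by_cases hxy : x = y
    · simp [hxy]
    · rw [gibbs_mul_generatorM₂ Q π U hT hxy]; ring
  have hV : 2 * (∑ x, gibbs π U T x * f x ^ 2 - (∑ x, gibbs π U T x * f x) ^ 2) ≤
      S * Real.exp (cM₂ Q U / T) * D / Z ^ 2 := by
    rw [← sum_sum_mul_sq_sub (sum_gibbs hπ U T), le_div_iff₀ (by positivity)]
    calc (∑ x, ∑ y, gibbs π U T x * gibbs π U T y * (f x - f y) ^ 2) * Z ^ 2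
        = ∑ x, ∑ y, (Real.exp (-U x / T) * π x) * (Real.exp (-U y / T) * π y) *
            (f x - f y) ^ 2 := by
          simp only [Finset.sum_mul, gibbs]
          refine Finset.sum_congr rfl fun x _ => Finset.sum_congr rfl fun y _ => ?_
          rw [← hZ]
          field_simp
      _ ≤ ∑ x, ∑ y, K x y * Real.exp (cM₂ Q U / T) * D :=
          Finset.sum_le_sum fun x _ => Finset.sum_le_sum fun y _ => hK x y T hT f
      _ = (∑ x, ∑ y, K x y) * Real.exp (cM₂ Q U / T) * D := by simp only [Finset.sum_mul]
      _ ≤ S * Real.exp (cM₂ Q U / T) * D := by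
          gcongr; linarith
  rw [hR]
  calc _ = (π x₀ / S * Real.exp (-cM₂ Q U / T)) *
        (2 * (∑ x, gibbs π U T x * f x ^ 2 - (∑ x, gibbs π U T x * f x) ^ 2)) := by ring
    _ ≤ (π x₀ / S * Real.exp (-cM₂ Q U / T)) * (S * Real.exp (cM₂ Q U / T) * D / Z ^ 2) := by
        have := hπ x₀
        gcongr
    _ = π x₀ * D / Z ^ 2 := by
        rw [neg_div, Real.exp_neg]
        field_simp
    _ ≤ Z * D / Z ^ 2 := by gcongr
    _ = D / Z := by field_simp

/-! ### A differential inequality -/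

/-- Once `B / (t + 1) ≤ A (t + 1) ^ (-α) min δ 1`, the hypothesis gives
`(V - δ)' ≤ -A (t + 1) ^ (-α) (V - δ)`. As `(t + 1) ^ (-α)` has infinite integral, eventually
`V < 2 δ`. -/
theorem tendsto_zero_of_deriv_le {V V' : ℝ → ℝ} {s A B α : ℝ} (hs : 0 ≤ s) (hA : 0 < A)
    (hα : α < 1) (hV0 : ∀ t, s < t → 0 ≤ V t)
    (hV : ∀ t, s < t → HasDerivAt V (V' t) t)
    (hle : ∀ t, s < t → V' t ≤ -(2 * A * (t + 1) ^ (-α)) * V t + B / (t + 1) * (V t + 1)) :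
    Tendsto V atTop (𝓝 0) := by
  have hα' : 0 < 1 - α := sub_pos.2 hα
  have hadd : Tendsto (fun t : ℝ => t + 1) atTop atTop :=
    tendsto_atTop_add_const_right _ _ tendsto_id
  refine tendsto_order.2 ⟨fun a ha => ?_, fun a ha => ?_⟩
  · filter_upwards [eventually_gt_atTop s] with t ht using ha.trans_le (hV0 t ht)
  set δ := a / 2 with hδdef
  have hδ : 0 < δ := half_pos ha
  have hm : 0 < min δ 1 := lt_min hδ one_pos
  have hsmall : ∀ᶠ t : ℝ in atTop, B * (t + 1) ^ (-(1 - α)) < A * min δ 1 := by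
    have h := ((tendsto_rpow_neg_atTop hα').comp hadd).const_mul B
    rw [mul_zero] at h
    exact h.eventually_lt_const (mul_pos hA hm)
  obtain ⟨t₀, ht₀⟩ := eventually_atTop.1 (hsmall.and (eventually_gt_atTop s))
  set E : ℝ → ℝ := fun t => Real.exp (A / (1 - α) * (t + 1) ^ (1 - α)) with hE
  have hW : ∀ t, t₀ ≤ t → HasDerivAt (fun t => (V t - δ) * E t)
      ((V' t + (V t - δ) * (A * (t + 1) ^ (-α))) * E t) t := by
    intro t ht
    have hst := (ht₀ t ht).2
    have hpos : 0 < t + 1 := by linarith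
    have h1 : HasDerivAt (fun t : ℝ => (t + 1) ^ (1 - α)) ((1 - α) * (t + 1) ^ (-α)) t := by
      have := ((hasDerivAt_id t).add_const 1).rpow_const (p := 1 - α) (Or.inl hpos.ne')
      rwa [one_mul, show 1 - α - 1 = -α by ring] at this
    have h2 := ((hV t hst).sub_const δ).mul (h1.const_mul (A / (1 - α))).exp
    refine h2.congr_deriv ?_
    change V' t * E t + _ * (E t * _) = _
    field_simp
  have hanti : AntitoneOn (fun t => (V t - δ) * E t) (Set.Ici t₀) := by
    refine antitoneOn_of_deriv_nonpos (convex_Ici t₀)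
      (fun t ht => (hW t ht).continuousAt.continuousWithinAt)
      (fun t ht => (hW t (interior_subset ht)).differentiableAt.differentiableWithinAt)
      fun t ht => ?_
    have ht := interior_subset ht
    rw [(hW t ht).deriv]
    refine mul_nonpos_of_nonpos_of_nonneg ?_ (Real.exp_pos _).le
    obtain ⟨h1, hst⟩ := ht₀ t ht
    have hpos : 0 < t + 1 := by linarith
    have hV0t := hV0 t hst
    have hlam : 0 < (t + 1) ^ (-α) := Real.rpow_pos_of_pos hpos _
    have hsplit : B / (t + 1) = B * (t + 1) ^ (-(1 - α)) * (t + 1) ^ (-α) := by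
      rw [mul_assoc, ← Real.rpow_add hpos, show -(1 - α) + -α = -1 by ring, Real.rpow_neg_one]
      rfl
    have hb : B / (t + 1) ≤ A * min δ 1 * (t + 1) ^ (-α) := by
      rw [hsplit]; gcongr
    have hb1 : B / (t + 1) * (V t + 1) ≤ A * (t + 1) ^ (-α) * V t + A * (t + 1) ^ (-α) * δ := by
      calc B / (t + 1) * (V t + 1) ≤ A * min δ 1 * (t + 1) ^ (-α) * (V t + 1) := by gcongr
        _ = A * (t + 1) ^ (-α) * (V t * min δ 1) + A * (t + 1) ^ (-α) * min δ 1 := by ring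
        _ ≤ A * (t + 1) ^ (-α) * (V t * 1) + A * (t + 1) ^ (-α) * δ := by
          gcongr
          · exact min_le_right _ _
          · exact min_le_left _ _
        _ = _ := by ring
    linarith [hle t hst]
  have hEtop : Tendsto E atTop atTop :=
    Real.tendsto_exp_atTop.comp
      (((tendsto_rpow_atTop hα').comp hadd).const_mul_atTop (div_pos hA hα'))
  have hlim := (hEtop.inv_tendsto_atTop.const_mul ((V t₀ - δ) * E t₀)).eventually_lt_const
    (show (V t₀ - δ) * E t₀ * 0 < δ by simpa using hδ)
  filter_upwards [hlim, eventually_ge_atTop t₀] with t h1 ht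
  have h2 : (V t - δ) * E t ≤ (V t₀ - δ) * E t₀ := hanti Set.self_mem_Ici ht ht
  have h3 : V t - δ ≤ (V t₀ - δ) * E t₀ * (E t)⁻¹ := by
    rw [← div_eq_mul_inv, le_div_iff₀ (Real.exp_pos _)]
    exact h2
  have h4 : (V t₀ - δ) * E t₀ * (E t)⁻¹ < δ := h1
  linarith

/-! ### The chi-square divergence -/

/-- The chi-square divergence `∑ μ² / ν - 1` of `μ` from `ν`; it is `∑ (μ - ν)² / ν` when both have
total mass `1` and `ν` is positive. -/
noncomputable def chiSq [Fintype X] (ν μ : X → ℝ) : ℝ :=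
  ∑ x, μ x ^ 2 / ν x - 1

lemma chiSq_eq_sum [Fintype X] {ν μ : X → ℝ} (hν : ∀ x, 0 < ν x) (hν1 : ∑ x, ν x = 1)
    (hμ1 : ∑ x, μ x = 1) : chiSq ν μ = ∑ x, (μ x - ν x) ^ 2 / ν x := by
  have h : ∀ x, (μ x - ν x) ^ 2 / ν x = μ x ^ 2 / ν x - 2 * μ x + ν x := fun x => by
    have := (hν x).ne'
    field_simp
    ring
  simp only [h, Finset.sum_add_distrib, Finset.sum_sub_distrib, ← Finset.mul_sum, hν1, hμ1, chiSq]
  ring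

lemma chiSq_nonneg [Fintype X] {ν μ : X → ℝ} (hν : ∀ x, 0 < ν x) (hν1 : ∑ x, ν x = 1)
    (hμ1 : ∑ x, μ x = 1) : 0 ≤ chiSq ν μ := by
  rw [chiSq_eq_sum hν hν1 hμ1]
  exact Finset.sum_nonneg fun x _ => div_nonneg (sq_nonneg _) (hν x).le

lemma tvDist_nonneg [Fintype X] (μ ν : X → ℝ) : 0 ≤ tvDist μ ν :=
  mul_nonneg (by norm_num) (Finset.sum_nonneg fun _ _ => abs_nonneg _)

lemma tvDist_triangle [Fintype X] (μ ν ρ : X → ℝ) : tvDist μ ρ ≤ tvDist μ ν + tvDist ν ρ := by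
  rw [tvDist, tvDist, tvDist, ← mul_add, ← Finset.sum_add_distrib]
  gcongr
  exact abs_sub_le _ _ _

lemma tvDist_le_sqrt_chiSq [Fintype X] {ν μ : X → ℝ} (hν : ∀ x, 0 < ν x) (hν1 : ∑ x, ν x = 1)
    (hμ1 : ∑ x, μ x = 1) : tvDist μ ν ≤ √(chiSq ν μ) := by
  have h := Finset.sq_sum_div_le_sum_sq_div Finset.univ (fun x => |μ x - ν x|)
    (fun x _ => hν x)
  simp only [sq_abs, hν1, div_one, ← chiSq_eq_sum hν hν1 hμ1] at h
  have h1 := Real.le_sqrt_of_sq_le h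
  have h2 : 0 ≤ ∑ x, |μ x - ν x| := Finset.sum_nonneg fun _ _ => abs_nonneg _
  rw [tvDist]
  linarith

lemma relEntropy_nonneg [Fintype X] {ν μ : X → ℝ} (hν : ∀ x, 0 < ν x) (hν1 : ∑ x, ν x = 1)
    (hμ : ∀ x, 0 ≤ μ x) (hμ1 : ∑ x, μ x = 1) : 0 ≤ relEntropy ν μ := by
  have h : ∑ x, (μ x - ν x) ≤ relEntropy ν μ := by
    refine Finset.sum_le_sum fun x _ => ?_
    rcases (hμ x).eq_or_lt with h0 | h0
    · simp [← h0, (hν x).le]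
    · have h1 := Real.one_sub_inv_le_log_of_pos (div_pos h0 (hν x))
      calc μ x - ν x = μ x * (1 - (μ x / ν x)⁻¹) := by field_simp
        _ ≤ _ := by gcongr
  rwa [Finset.sum_sub_distrib, hν1, hμ1, sub_self] at h

lemma relEntropy_le_chiSq [Fintype X] {ν μ : X → ℝ} (hν : ∀ x, 0 < ν x)
    (hμ : ∀ x, 0 ≤ μ x) (hμ1 : ∑ x, μ x = 1) : relEntropy ν μ ≤ chiSq ν μ := by
  have h : relEntropy ν μ ≤ ∑ x, (μ x ^ 2 / ν x - μ x) := by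
    refine Finset.sum_le_sum fun x _ => ?_
    rcases (hμ x).eq_or_lt with h0 | h0
    · simp [← h0]
    · have h1 := Real.log_le_sub_one_of_pos (div_pos h0 (hν x))
      calc μ x * Real.log (μ x / ν x) ≤ μ x * (μ x / ν x - 1) := by gcongr
        _ = _ := by ring
  rwa [Finset.sum_sub_distrib, hμ1] at h

/-! ### The cooling schedule -/

lemma div_logCooling (a c t : ℝ) : a / logCooling c t = a * Real.log (t + 1) / c := by
  rw [logCooling, div_div_eq_mul_div]

lemma logCooling_nonneg {c t : ℝ} (hc : 0 ≤ c) (ht : 0 ≤ t) : 0 ≤ logCooling c t :=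
  div_nonneg hc (Real.log_nonneg (by linarith))

lemma hasDerivAt_exp_div_logCooling (a c : ℝ) {t : ℝ} (ht : 0 ≤ t) :
    HasDerivAt (fun u => Real.exp (a / logCooling c u))
      (Real.exp (a / logCooling c t) * (a / (c * (t + 1)))) t := by
  have hpos : 0 < t + 1 := by linarith
  simp only [div_logCooling]
  refine HasDerivAt.congr_deriv
    (((((hasDerivAt_id t).add_const 1).log hpos.ne').const_mul a).div_const c).exp ?_
  rw [id]
  field_simp

lemma tendsto_exp_neg_div_logCooling {c : ℝ} (hc : 0 < c) {a : ℝ} (ha : 0 < a) :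
    Tendsto (fun t => Real.exp (-a / logCooling c t)) atTop (𝓝 0) := by
  have hadd : Tendsto (fun t : ℝ => t + 1) atTop atTop :=
    tendsto_atTop_add_const_right _ _ tendsto_id
  have h : Tendsto (fun t : ℝ => a / c * Real.log (t + 1)) atTop atTop :=
    (Real.tendsto_log_atTop.comp hadd).const_mul_atTop (div_pos ha hc)
  refine (Real.tendsto_exp_neg_atTop_nhds_zero.comp h).congr fun t => ?_
  simp only [Function.comp, div_logCooling]
  congr 1
  ring

open Classical in
lemma tendsto_gibbs_piMin [Fintype X] {π U : X → ℝ} (hπ : ∀ x, 0 < π x)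
    (hU : IsLeast (Set.range U) 0) {c : ℝ} (hc : 0 < c) (x : X) :
    Tendsto (fun t => gibbs π U (logCooling c t) x) atTop (𝓝 (piMin π U x)) := by
  have hU0 : ∀ x, 0 ≤ U x := fun x => hU.2 ⟨x, rfl⟩
  obtain ⟨x₀, hx₀⟩ := hU.1
  have hmin : ∀ x, x ∈ globalMinima U ↔ U x = 0 := fun x =>
    ⟨fun h => le_antisymm (hx₀ ▸ h x₀) (hU0 x), fun h y => h ▸ hU0 y⟩
  have hw : ∀ x, Tendsto (fun t => Real.exp (-U x / logCooling c t) * π x) atTop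
      (𝓝 (if x ∈ globalMinima U then π x else 0)) := by
    intro x
    by_cases hx : U x = 0
    · simp [hmin, hx]
    · rw [if_neg (by rwa [hmin])]
      simpa using (tendsto_exp_neg_div_logCooling hc ((hU0 x).lt_of_ne' hx)).mul_const (π x)
  have hZ := tendsto_finsetSum Finset.univ fun x _ => hw x
  rw [← Finset.sum_filter] at hZ
  have hpos : 0 < ∑ y ∈ Finset.univ.filter (fun y => y ∈ globalMinima U), π y :=
    Finset.sum_pos (fun y _ => hπ y) ⟨x₀, by simp [hmin, hx₀]⟩
  have := (hw x).div hZ hpos.ne'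
  simp only [piMin]
  rwa [ite_div, zero_div] at this

/-- Writing `chiSq + 1` as `Z * ∑ μ² exp (U / T) / π`, with `Z` the partition function, the decrease
of `Z` along the cooling helps, and the growth of `exp (U / T)` costs at most a factor
`∑ U / (c (t + 1))`. -/
lemma exists_hasDerivAt_chiSq_gibbs [Fintype X] [Nonempty X] {π U : X → ℝ} (hπ : ∀ x, 0 < π x)
    (hU : ∀ x, 0 ≤ U x) {c : ℝ} (hc : 0 < c) {t : ℝ} (ht : 0 ≤ t) {μ : ℝ → X → ℝ} {μ' : X → ℝ}
    (hμ : ∀ y, HasDerivAt (fun u => μ u y) (μ' y) t) :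
    ∃ V', HasDerivAt (fun u => chiSq (gibbs π U (logCooling c u)) (μ u)) V' t ∧
      V' ≤ 2 * ∑ y, μ t y / gibbs π U (logCooling c t) y * μ' y +
        (∑ y, U y) / c / (t + 1) * (chiSq (gibbs π U (logCooling c t)) (μ t) + 1) := by
  have hpos : 0 < t + 1 := by linarith
  set Z : ℝ → ℝ := fun u => ∑ z, Real.exp (-U z / logCooling c u) * π z with hZ
  have hZpos : ∀ u, 0 < Z u := fun u => partition_pos hπ U _
  have hchi : ∀ u (a : X → ℝ), (∑ y, a y / gibbs π U (logCooling c u) y) =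
      Z u * ∑ y, a y * Real.exp (U y / logCooling c u) / π y := by
    intro u a
    rw [Finset.mul_sum]
    refine Finset.sum_congr rfl fun y _ => ?_
    have := (hπ y).ne'
    have := (hZpos u).ne'
    rw [gibbs, neg_div, Real.exp_neg]
    change a y / (_ / Z u) = _
    field_simp
  have hZ' : HasDerivAt Z
      (∑ z, Real.exp (-U z / logCooling c t) * (-U z / (c * (t + 1))) * π z) t :=
    HasDerivAt.fun_sum fun z _ => (hasDerivAt_exp_div_logCooling _ c ht).mul_const _
  have hS' : HasDerivAt (fun u => ∑ y, μ u y ^ 2 * Real.exp (U y / logCooling c u) / π y)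
      (∑ y, (2 * μ t y * μ' y * Real.exp (U y / logCooling c t) + μ t y ^ 2 *
        (Real.exp (U y / logCooling c t) * (U y / (c * (t + 1))))) / π y) t := by
    refine HasDerivAt.fun_sum fun y _ => HasDerivAt.div_const ?_ _
    simpa using ((hμ y).fun_pow 2).fun_mul (hasDerivAt_exp_div_logCooling (U y) c ht)
  refine ⟨_, ((hZ'.mul hS').sub_const 1).congr_of_eventuallyEq
    (Eventually.of_forall fun u => ?_), ?_⟩
  · simp only [chiSq, hchi]
    rfl
  have hZ'0 : ∑ z, Real.exp (-U z / logCooling c t) * (-U z / (c * (t + 1))) * π z ≤ 0 := by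
    refine Finset.sum_nonpos fun z _ => ?_
    refine mul_nonpos_of_nonpos_of_nonneg (mul_nonpos_of_nonneg_of_nonpos (Real.exp_pos _).le ?_)
      (hπ z).le
    exact div_nonpos_of_nonpos_of_nonneg (neg_nonpos.2 (hU z)) (by positivity)
  have hS0 : 0 ≤ ∑ y, μ t y ^ 2 * Real.exp (U y / logCooling c t) / π y :=
    Finset.sum_nonneg fun y _ => by have := hπ y; positivity
  have hfirst : 2 * ∑ y, μ t y / gibbs π U (logCooling c t) y * μ' y =
      Z t * ∑ y, 2 * μ t y * μ' y * Real.exp (U y / logCooling c t) / π y := by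
    rw [← hchi t fun y => 2 * μ t y * μ' y, Finset.mul_sum]
    exact Finset.sum_congr rfl fun y _ => by ring
  have hsecond : ∑ y, μ t y ^ 2 *
        (Real.exp (U y / logCooling c t) * (U y / (c * (t + 1)))) / π y ≤
      (∑ y, U y) / c / (t + 1) * ∑ y, μ t y ^ 2 * Real.exp (U y / logCooling c t) / π y := by
    rw [Finset.mul_sum]
    refine Finset.sum_le_sum fun y _ => ?_
    have h1 : U y ≤ ∑ y, U y := Finset.single_le_sum (fun z _ => hU z) (Finset.mem_univ y)
    have := hπ y
    calc _ = U y / c / (t + 1) * (μ t y ^ 2 * Real.exp (U y / logCooling c t) / π y) := by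
          field_simp
      _ ≤ _ := by gcongr
  have h3 := mul_le_mul_of_nonneg_left hsecond (hZpos t).le
  have h4 := mul_nonpos_of_nonpos_of_nonneg hZ'0 hS0
  rw [hfirst, chiSq, sub_add_cancel, hchi]
  simp only [add_div, Finset.sum_add_distrib]
  rw [mul_add (Z t)]
  linarith

/-! ### Convergence of the annealed chain -/

theorem tendsto_chiSq [Fintype X] [DecidableEq X] {Q : Matrix X X ℝ} {π U : X → ℝ}
    (hQ : IsGenerator Q) (hirr : IsIrreducible Q) (hπ : ∀ x, 0 < π x) (hrev : IsReversible Q π)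
    (hU : IsLeast (Set.range U) 0) {c : ℝ} (hc0 : 0 < c) (hc : cM₂ Q U < c)
    {P : ℝ → ℝ → Matrix X X ℝ}
    (hP : IsTransitionSemigroup (fun t => generatorM₂ Q U (logCooling c t)) P)
    {s : ℝ} (hs : 0 ≤ s) (x : X) :
    Tendsto (fun t => chiSq (gibbs π U (logCooling c t)) (P s t x)) atTop (𝓝 0) := by
  have : Nonempty X := ⟨x⟩
  have hU0 : ∀ x, 0 ≤ U x := fun x => hU.2 ⟨x, rfl⟩
  obtain ⟨A, hA, hpoinc⟩ := exists_poincare hQ hirr hπ hU.1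
  have hderiv : ∀ t, s < t → ∃ V', HasDerivAt
      (fun u => chiSq (gibbs π U (logCooling c u)) (P s u x)) V' t ∧
      V' ≤ -(2 * A * (t + 1) ^ (-(cM₂ Q U / c))) *
          chiSq (gibbs π U (logCooling c t)) (P s t x) +
        (∑ y, U y) / c / (t + 1) * (chiSq (gibbs π U (logCooling c t)) (P s t x) + 1) := by
    intro t hst
    have ht : 0 ≤ t := hs.trans hst.le
    obtain ⟨V', hV', hle⟩ := exists_hasDerivAt_chiSq_gibbs (μ := fun u => P s u x) hπ hU0 hc0 ht
      fun y => (hP.forward s t hs hst.le x y).hasDerivAt (Ici_mem_nhds hst)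
    refine ⟨V', hV', hle.trans (add_le_add_left ?_ _)⟩
    have hT := logCooling_nonneg hc0.le ht
    set g := gibbs π U (logCooling c t) with hg
    have hgpos : ∀ y, 0 < g y := gibbs_pos hπ U _
    set f : X → ℝ := fun y => P s t x y / g y with hf
    have hgf : ∀ y, g y * f y = P s t x y := fun y => mul_div_cancel₀ _ (hgpos y).ne'
    have hdir := (isReversible_generatorM₂ hrev U hT).sum_mul_sum (sum_generatorM₂ Q U _) f
    have hp := hpoinc _ hT f
    rw [← hg] at hdir hp
    -- `∑ y, g y * f y = ∑ y, P s t x y = 1`, so the variance of the density `f` is `chiSq`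
    have hvar : ∑ y, g y * f y ^ 2 - (∑ y, g y * f y) ^ 2 = chiSq g (P s t x) := by
      have h1 : ∑ y, P s t x y = 1 := (hP.stochastic s t hs hst.le x).2
      simp only [hgf, h1, one_pow, chiSq]
      congr 1
      refine Finset.sum_congr rfl fun y _ => ?_
      rw [sq, ← mul_assoc, hgf, hf]
      ring
    have hexp : Real.exp (-cM₂ Q U / logCooling c t) = (t + 1) ^ (-(cM₂ Q U / c)) := by
      rw [div_logCooling, Real.rpow_def_of_pos (by linarith)]
      congr 1
      ring
    simp only [hgf] at hdir
    simp only [Matrix.mul_apply]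
    rw [hvar, hexp] at hp
    linarith
  choose! V' hV' hle using hderiv
  refine tendsto_zero_of_deriv_le hs hA ((div_lt_one hc0).2 hc) (fun t ht => ?_) hV' hle
  exact chiSq_nonneg (gibbs_pos hπ U _) (sum_gibbs hπ U _) (hP.stochastic s t hs ht.le x).2

end Annealing

theorem theorem3p2 {X : Type*} [Fintype X] [DecidableEq X]
    (Q : Matrix X X ℝ) (π U : X → ℝ)
    (hQ : Annealing.IsGenerator Q) (hirr : Annealing.IsIrreducible Q)
    (hπ : π ∈ stdSimplex ℝ X) (hrev : Annealing.IsReversible Q π)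
    (hU : IsLeast (Set.range U) 0)
    (hc : 0 < Annealing.cM₂ Q U) (ε : ℝ) (hε : 0 < ε)
    (T : ℝ → ℝ) (hT : T = Annealing.logCooling (Annealing.cM₂ Q U + ε))
    (P : ℝ → ℝ → Matrix X X ℝ)
    (hP : Annealing.IsTransitionSemigroup (fun t => Annealing.generatorM₂ Q U (T t)) P) :
    (Annealing.IsStronglyErgodic P ∧ Annealing.IsStronglyErgodicTo P (Annealing.piMin π U)) ∧
      Annealing.ConvergesInRelEntropy (fun t => Annealing.generatorM₂ Q U (T t)) P
        (fun t => Annealing.gibbs π U (T t)) := by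
  subst hT
  open Annealing in
  have hπ0 := pos_of_isReversible hirr hπ hrev
  have : Nonempty X := ⟨hU.1.choose⟩
  have hc0 : 0 < cM₂ Q U + ε := by linarith
  have hgpos := fun t => gibbs_pos hπ0 U (logCooling (cM₂ Q U + ε) t)
  have hg1 := fun t => sum_gibbs hπ0 U (logCooling (cM₂ Q U + ε) t)
  have hlim := fun x => tendsto_gibbs_piMin hπ0 hU hc0 x
  have hchi := fun s (hs : 0 ≤ s) x =>
    tendsto_chiSq hQ hirr hπ0 hrev hU hc0 (lt_add_of_pos_right _ hε) hP hs x
  have hmain : IsStronglyErgodicTo P (piMin π U) := by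
    refine ⟨⟨fun x => ge_of_tendsto' (hlim x) fun t => (hgpos t x).le, ?_⟩, fun s hs => ?_⟩
    · refine tendsto_nhds_unique (tendsto_finsetSum Finset.univ fun x _ => hlim x) ?_
      simp only [hg1, tendsto_const_nhds]
    have htv : Tendsto (fun t => tvDist (gibbs π U (logCooling (cM₂ Q U + ε) t)) (piMin π U))
        atTop (𝓝 0) := by
      have := (tendsto_finsetSum Finset.univ fun x _ =>
        ((hlim x).sub_const (piMin π U x)).abs).const_mul (1 / 2 : ℝ)
      simpa [tvDist] using this
    have hbound := tendsto_finsetSum Finset.univ fun x _ => ((hchi s hs x).sqrt.add htv)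
    simp only [Real.sqrt_zero, add_zero, Finset.sum_const_zero] at hbound
    refine squeeze_zero' (Eventually.of_forall fun t => Real.iSup_nonneg fun x => tvDist_nonneg _ _)
      ?_ hbound
    filter_upwards [eventually_ge_atTop s] with t hst
    refine ciSup_le fun x => ?_
    refine le_trans ?_ (Finset.single_le_sum
      (f := fun x => √(chiSq (gibbs π U (logCooling (cM₂ Q U + ε) t)) (P s t x)) +
        tvDist (gibbs π U (logCooling (cM₂ Q U + ε) t)) (piMin π U))
      (fun x _ => add_nonneg (Real.sqrt_nonneg _) (tvDist_nonneg _ _)) (Finset.mem_univ x))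
    refine (tvDist_triangle _ (gibbs π U (logCooling (cM₂ Q U + ε) t)) _).trans ?_
    gcongr
    exact tvDist_le_sqrt_chiSq (hgpos t) (hg1 t) (hP.stochastic s t hs hst x).2
  refine ⟨⟨⟨_, hmain⟩, hmain⟩, fun t ht => ⟨⟨fun x => (hgpos t x).le, hg1 t⟩, fun y => ?_⟩,
    fun x => ?_⟩
  · exact (isReversible_generatorM₂ hrev U (logCooling_nonneg hc0.le ht)).sum_mul
      (sum_generatorM₂ Q U _) y
  · refine squeeze_zero' ?_ ?_ (hchi 0 le_rfl x)
    all_goals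
      filter_upwards [eventually_ge_atTop 0] with t ht
      obtain ⟨h0, h1⟩ := hP.stochastic 0 t le_rfl ht x
    · exact relEntropy_nonneg (hgpos t) (hg1 t) h0 h1
    · exact relEntropy_le_chiSq (hgpos t) h0 h1
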